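/- Let $X$ be a Banach space over $\mathbb K=\mathbb R$ or $\mathbb C$. A (linear) relation is a linear subspace $A\subset X\times X$; it is closed if it is closed in $X\times X$. For $\lambda\in\mathbb K$ put $\lambda-A=\{(x,\lambda x-y):(x,y)\in A\}$. The relation $A$ is dissipative if $\|\lambda x\|\le\|\lambda x-y\|$ for all $(x,y)\in A$ and all real $\lambda>0$, and $m$-dissipative if in addition the range $\{z : (x,z)\in\lambda-A \text{ for some } x\in X\}$ of $\lambda-A$ is $X$ for some real $\lambda>0$. For $x\in X$, a mild solution of $$\dot u(t)\in Au(t)+x\quad (t>0),\qquad u(0)=0 \tag{1}$$ is a function $u\in C([0,\infty),X)$ with $u(0)=0$ and $\bigl(\int_0^t u(s)\,ds,\;u(t)-tx\bigr)\in A$ for all $t\ge 0$. Theorem. Let $A\subset X\times X$ be a closed relation. Then $A$ is $m$-dissipative if and only if for every $x\in X$ problem (1) has a unique mild solution $u$, and this solution satisfies $$\|u(t)-u(s)\|\le |t-s|\,\|x\|\qquad (s,t\ge 0).$$ In that case, for every $x\in X$ the unique mild solution of (1) is $u(t)=S(t)x$ $(t\ge0)$, where $S$ is the integrated semigroup generated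 by $A$, that is, the unique function $S:[0,\infty)\to\mathcal L(X)$ such that $S(0)=0$, $\|S(t)-S(s)\|\le|t-s|$ for all $s,t\ge0$, and, for every $\lambda>0$, $(\lambda-A)^{-1}=\{(y,R(\lambda,A)y):y\in X\}$ with $R(\lambda,A)=\lambda\int_0^\infty e^{-\lambda t}S(t)\,dt\in\mathcal L(X)$ (such an $S$ exists and is unique). -/

import Mathlib

open Set MeasureTheory

noncomputable section

namespace LinRel

section Algebraic

variable {𝕜 X : Type*} [RCLike 𝕜] [NormedAddCommGroup X] [NormedSpace 𝕜 X]

/-- The range of a linear relation `A ⊆ X × X`. -/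
def ran (A : Submodule 𝕜 (X × X)) : Submodule 𝕜 X :=
  A.map (LinearMap.snd 𝕜 X X)

/-- The inverse relation `A⁻¹ = {(y, x) : (x, y) ∈ A}`. -/
def inverse (A : Submodule 𝕜 (X × X)) : Submodule 𝕜 (X × X) :=
  A.map ((LinearMap.snd 𝕜 X X).prod (LinearMap.fst 𝕜 X X))

/-- The relation `l - A = {(x, l x - y) : (x, y) ∈ A}`. -/
def shift (l : 𝕜) (A : Submodule 𝕜 (X × X)) : Submodule 𝕜 (X × X) :=
  A.map ((LinearMap.fst 𝕜 X X).prod (l • LinearMap.fst 𝕜 X X - LinearMap.snd 𝕜 X X))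

/-- `l` belongs to the resolvent set of `A` and `R` is the resolvent `R(l, A)`:
`R` is a bounded operator on `X` with `(l - A)⁻¹ = {(y, R y) : y ∈ X}`. -/
def IsResolventAt (A : Submodule 𝕜 (X × X)) (l : 𝕜) (R : X →L[𝕜] X) : Prop :=
  (inverse (shift l A) : Set (X × X)) = {p | ∃ y : X, p = (y, R y)}

/-- `A` is dissipative: `‖l x‖ ≤ ‖l x - y‖` for all `(x, y) ∈ A` and all real `l > 0`. -/
def Dissipative (A : Submodule 𝕜 (X × X)) : Prop :=
  ∀ x y : X, (x, y) ∈ A → ∀ l : ℝ, 0 < l → ‖(l : 𝕜) • x‖ ≤ ‖(l : 𝕜) • x - y‖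

/-- `A` is m-dissipative: dissipative, and `ran (l - A) = X` for some real `l > 0`. -/
def MDissipative (A : Submodule 𝕜 (X × X)) : Prop :=
  Dissipative A ∧ ∃ l : ℝ, 0 < l ∧ ran (shift (l : 𝕜) A) = ⊤

theorem mem_ran {A : Submodule 𝕜 (X × X)} {y : X} : y ∈ ran A ↔ ∃ x, (x, y) ∈ A := by
  simp [ran]

theorem mem_inverse {A : Submodule 𝕜 (X × X)} {x y : X} :
    (y, x) ∈ inverse A ↔ (x, y) ∈ A := by
  simp [inverse]

theorem mem_shift {A : Submodule 𝕜 (X × X)} {l : 𝕜} {x z : X} :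
    (x, z) ∈ shift l A ↔ ∃ y, (x, y) ∈ A ∧ l • x - y = z := by
  simp [shift]

end Algebraic

section Evolution

variable {𝕜 X : Type*} [RCLike 𝕜] [NormedAddCommGroup X] [NormedSpace 𝕜 X]
  [NormedSpace ℝ X] [IsScalarTower ℝ 𝕜 X]

/-- `u` (only its restriction to `[0, ∞)` matters) is a mild solution of
`u'(t) ∈ A u(t) + x`, `t > 0`, `u(0) = 0`. -/
structure IsMildSolution (A : Submodule 𝕜 (X × X)) (x : X) (u : ℝ → X) : Prop where
  continuousOn : ContinuousOn u (Ici 0)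
  initial : u 0 = 0
  mem : ∀ t : ℝ, 0 ≤ t → ((∫ s in (0 : ℝ)..t, u s), u t - t • x) ∈ A

/-- `S` (only its restriction to `[0, ∞)` matters) is the integrated semigroup generated by `A`:
`S(0) = 0`, `S` is 1-Lipschitz in operator norm, and for every `l > 0` the operator
`l ∫₀^∞ e^{-lt} S(t) dt` is the resolvent `R(l, A)`. The integral is a convergent Bochner integral
in the Banach space of bounded operators, because `‖S(t)‖ ≤ t` by the first two clauses. -/
structure IsIntegratedSemigroupOf (A : Submodule 𝕜 (X × X)) (S : ℝ → X →L[𝕜] X) : Prop where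
  zero : S 0 = 0
  lipschitz : ∀ s t : ℝ, 0 ≤ s → 0 ≤ t → ‖S t - S s‖ ≤ |t - s|
  resolvent : ∀ l : ℝ, 0 < l →
    IsResolventAt A (l : 𝕜) (l • ∫ t in Ioi (0 : ℝ), Real.exp (-(l * t)) • S t)

end Evolution

end LinRel

end

/-! ### Integrals with an exponential weight. -/

open Filter Topology

/-! An m-dissipative `A` has contractive resolvents `R l` for all `l > 0` (Neumann series). They
satisfy the resolvent identity but need not be injective or have dense range, so there may be no
semigroup to integrate. The Yosida approximations `a n = n (n R n - 1)` still generate contraction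
semigroups `exp (t a n)`. These converge in operator norm after multiplication by the smoothing
factor `R 1`. For bounded `a` the integrated semigroup `s` satisfies `s = (s - exp (t a) + 1) (1 -
a)⁻¹`, and `(1 - a n)⁻¹ → R 1` in norm. So the integrated semigroups themselves converge in norm,
without any density assumption (`norm_integratedExp_yosida_sub_le`). The limit `S` is 1-Lipschitz
with Laplace transform `R`, and passing to the limit in `(∫ s) a = s - t` shows that `S t x` is a
mild solution.

Mild solutions are unique because the integral `W` of a difference of two of them satisfies `(W, W')
∈ A` and `W 0 = 0`, and dissipativity then forces `W = 0`. The generated `S` is unique by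
injectivity of the Laplace transform (`eq_zero_of_laplace_eq_zero`).

Conversely, the Laplace transform of a mild solution lies in the closed space `A` and solves the
resolvent equation with the contraction bound (`mem_of_laplace`). An eigenvector of `A` with
eigenvalue `l > 0` would produce an exponentially growing mild solution, which uniqueness and the
Lipschitz bound exclude. So `l - A` has trivial kernel, and the bound on the constructed solution of
the resolvent equation becomes dissipativity. -/

theorem integrableOn_one_add_sq_mul_exp_neg {l : ℝ} (hl : 0 < l) :
    IntegrableOn (fun t : ℝ => (1 + t ^ 2) * Real.exp (-(l * t))) (Ioi 0) := by
  have h0 : IntegrableOn (fun t : ℝ => Real.exp (-(l * t))) (Ioi 0) := by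
    simpa [neg_mul] using exp_neg_integrableOn_Ioi 0 hl
  have h2 := integrableOn_rpow_mul_exp_neg_mul_rpow (s := 2) (p := 1) (by norm_num) one_pos hl
  refine (h0.add h2).congr_fun (fun t _ => ?_) measurableSet_Ioi
  simp [add_mul]

theorem tendsto_one_add_sq_mul_exp_neg {l : ℝ} (hl : 0 < l) :
    Tendsto (fun t : ℝ => (1 + t ^ 2) * Real.exp (-(l * t))) atTop (𝓝 0) := by
  have h0 := tendsto_rpow_mul_exp_neg_mul_atTop_nhds_zero 0 l hl
  have h2 := tendsto_rpow_mul_exp_neg_mul_atTop_nhds_zero 2 l hl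
  simpa [add_mul] using h0.add h2

theorem integral_exp_neg_mul_Ioi_zero {l : ℝ} (hl : 0 < l) :
    ∫ t in Ioi (0 : ℝ), Real.exp (-(l * t)) = l⁻¹ := by
  have := integral_exp_mul_Ioi (a := -l) (by linarith) 0
  simpa using this

theorem integral_mul_exp_neg_mul_Ioi_zero {l : ℝ} (hl : 0 < l) :
    ∫ t in Ioi (0 : ℝ), t * Real.exp (-(l * t)) = (l ^ 2)⁻¹ := by
  have := Real.integral_rpow_mul_exp_neg_mul_Ioi (a := 2) (r := l) (by norm_num) hl
  norm_num at this
  exact this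

/-! ### Laplace transforms of functions of at most quadratic growth. -/

section Laplace

variable {E : Type*} [NormedAddCommGroup E] [NormedSpace ℝ E]

theorem integrableOn_exp_neg_smul {l : ℝ} (hl : 0 < l) {f : ℝ → E} {C : ℝ}
    (hf : ContinuousOn f (Ici 0)) (hC : ∀ t, 0 ≤ t → ‖f t‖ ≤ C * (1 + t ^ 2)) :
    IntegrableOn (fun t => Real.exp (-(l * t)) • f t) (Ioi 0) := by
  refine Integrable.mono' ((integrableOn_one_add_sq_mul_exp_neg hl).const_mul C) ?_ ?_
  · refine ContinuousOn.aestronglyMeasurable ?_ measurableSet_Ioi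
    exact ContinuousOn.smul (by fun_prop) (hf.mono Ioi_subset_Ici_self)
  · filter_upwards [ae_restrict_mem measurableSet_Ioi] with t ht
    rw [norm_smul, Real.norm_of_nonneg (Real.exp_pos _).le]
    nlinarith [hC t (le_of_lt ht), Real.exp_pos (-(l * t))]

theorem norm_smul_integral_exp_neg_smul_le {l : ℝ} (hl : 0 < l) {f : ℝ → E} {C : ℝ}
    (hC : ∀ t, 0 ≤ t → ‖f t‖ ≤ C * t) :
    ‖l • (l • ∫ t in Ioi (0 : ℝ), Real.exp (-(l * t)) • f t)‖ ≤ C := by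
  have hint : IntegrableOn (fun t : ℝ => t * Real.exp (-(l * t))) (Ioi 0) := by
    -- A non-integrable function has Bochner integral 0 by convention, whereas this integral is `(l
    -- ^ 2)⁻¹ > 0`.
    by_contra h
    have := integral_undef h
    rw [integral_mul_exp_neg_mul_Ioi_zero hl] at this
    have : 0 < (l ^ 2)⁻¹ := by positivity
    linarith
  have h := norm_integral_le_of_norm_le (μ := volume.restrict (Ioi (0 : ℝ)))
    (f := fun t => Real.exp (-(l * t)) • f t) (hint.const_mul C) (by
      filter_upwards [ae_restrict_mem measurableSet_Ioi] with t ht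
      rw [norm_smul, Real.norm_of_nonneg (Real.exp_pos _).le]
      nlinarith [hC t (le_of_lt ht), Real.exp_pos (-(l * t))])
  rw [integral_const_mul, integral_mul_exp_neg_mul_Ioi_zero hl] at h
  rw [norm_smul, norm_smul, Real.norm_of_nonneg hl.le]
  calc l * (l * _) ≤ l * (l * (C * (l ^ 2)⁻¹)) := by gcongr
    _ = C := by field_simp

/-- Integration by parts: the boundary term at 0 vanishes by `g 0 = 0`, the one at infinity by the
growth bound. -/
theorem smul_integral_exp_neg_smul_eq [CompleteSpace E] {l : ℝ} (hl : 0 < l) {g g' : ℝ → E}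
    {C C' : ℝ} (hg0 : g 0 = 0) (hg : ContinuousOn g (Ici 0)) (hg' : ContinuousOn g' (Ici 0))
    (hd : ∀ t, 0 < t → HasDerivAt g (g' t) t)
    (hC : ∀ t, 0 ≤ t → ‖g t‖ ≤ C * (1 + t ^ 2))
    (hC' : ∀ t, 0 ≤ t → ‖g' t‖ ≤ C' * (1 + t ^ 2)) :
    (l • ∫ t in Ioi (0 : ℝ), Real.exp (-(l * t)) • g t) =
      ∫ t in Ioi (0 : ℝ), Real.exp (-(l * t)) • g' t := by
  have i1 := integrableOn_exp_neg_smul hl hg hC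
  have i2 := integrableOn_exp_neg_smul hl hg' hC'
  have key := integral_Ioi_of_hasDerivAt_of_tendsto (a := 0) (m := 0)
    (f := fun t => Real.exp (-(l * t)) • g t)
    (f' := fun t => Real.exp (-(l * t)) • g' t - l • (Real.exp (-(l * t)) • g t))
    (by
      refine ContinuousWithinAt.smul ?_ (hg 0 self_mem_Ici)
      exact (by fun_prop : Continuous fun t => Real.exp (-(l * t))).continuousWithinAt)
    (fun t ht => by
      have h1 : HasDerivAt (fun t => Real.exp (-(l * t))) (Real.exp (-(l * t)) * -l) t := by
        have := ((hasDerivAt_id t).const_mul l).neg.exp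
        simpa using this
      refine (h1.smul (hd t ht)).congr_deriv ?_
      module)
    (i2.sub (i1.smul l))
    (by
      refine squeeze_zero_norm' (a := fun t => C * ((1 + t ^ 2) * Real.exp (-(l * t)))) ?_ ?_
      · filter_upwards [eventually_ge_atTop 0] with t ht
        rw [norm_smul, Real.norm_of_nonneg (Real.exp_pos _).le]
        nlinarith [hC t ht, Real.exp_pos (-(l * t))]
      · simpa using (tendsto_one_add_sq_mul_exp_neg hl).const_mul C)
  have i3 : IntegrableOn (fun t => l • (Real.exp (-(l * t)) • g t)) (Ioi 0) := i1.smul l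
  rw [integral_sub i2 i3, integral_smul] at key
  simp only [hg0, smul_zero, sub_zero] at key
  exact (sub_eq_zero.mp key).symm

theorem tendsto_integral_exp_neg_smul {l : ℝ} (hl : 0 < l) {F : ℕ → ℝ → E} {f : ℝ → E} {C : ℝ}
    (hF : ∀ n, ContinuousOn (F n) (Ici 0))
    (hC : ∀ n t, 0 ≤ t → ‖F n t‖ ≤ C * (1 + t ^ 2))
    (hlim : ∀ t, 0 ≤ t → Tendsto (fun n => F n t) atTop (𝓝 (f t))) :
    Tendsto (fun n => ∫ t in Ioi (0 : ℝ), Real.exp (-(l * t)) • F n t) atTop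
      (𝓝 (∫ t in Ioi (0 : ℝ), Real.exp (-(l * t)) • f t)) := by
  refine tendsto_integral_of_dominated_convergence
    (fun t => C * ((1 + t ^ 2) * Real.exp (-(l * t))))
    (fun n => (integrableOn_exp_neg_smul hl (hF n) (hC n)).aestronglyMeasurable)
    ((integrableOn_one_add_sq_mul_exp_neg hl).const_mul C) (fun n => ?_) ?_
  · filter_upwards [ae_restrict_mem measurableSet_Ioi] with t ht
    rw [norm_smul, Real.norm_of_nonneg (Real.exp_pos _).le]
    nlinarith [hC n t (le_of_lt ht), Real.exp_pos (-(l * t))]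
  · filter_upwards [ae_restrict_mem measurableSet_Ioi] with t ht
    exact (hlim t (le_of_lt ht)).const_smul _

end Laplace

/-! ### Contraction semigroups with bounded generator. -/

section Exponential

open NormedSpace

variable {B : Type*} [NormedCommRing B] [NormedAlgebra ℝ B]

/-- Asking only for `‖1‖ ≤ 1` admits the trivial algebra, which occurs when `X = 0`. -/
theorem NormedSpace.norm_exp_le_exp_norm (h1 : ‖(1 : B)‖ ≤ 1) (x : B) :
    ‖exp x‖ ≤ Real.exp ‖x‖ := by
  have hs := norm_expSeries_summable' (𝕂 := ℝ) x
  have hs' := expSeries_summable' (𝕂 := ℝ) ‖x‖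
  have hp : ∀ n : ℕ, ‖x ^ n‖ ≤ ‖x‖ ^ n := fun n => by
    rcases n.eq_zero_or_pos with rfl | hn
    · simpa using h1
    · exact norm_pow_le' x hn
  rw [exp_eq_tsum ℝ, Real.exp_eq_exp_ℝ, exp_eq_tsum ℝ]
  refine (norm_tsum_le_tsum_norm hs).trans (hs.tsum_le_tsum (fun n => ?_) hs')
  rw [norm_smul, smul_eq_mul, Real.norm_of_nonneg (by positivity)]
  gcongr
  exact hp n

variable [CompleteSpace B]

theorem norm_exp_smul_sub_one_le_one (h1 : ‖(1 : B)‖ ≤ 1) {c : B} (hc : ‖c‖ ≤ 1) {r t : ℝ}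
    (hr : 0 ≤ r) (ht : 0 ≤ t) : ‖exp (t • r • (c - 1))‖ ≤ 1 := by
  have e1 : t • r • (c - 1) = (t * r) • c + algebraMap ℝ B (-(t * r)) := by
    rw [Algebra.algebraMap_eq_smul_one]; module
  have e2 : exp (algebraMap ℝ B (-(t * r))) = algebraMap ℝ B (Real.exp (-(t * r))) := by
    rw [Real.exp_eq_exp_ℝ, algebraMap_exp_comm]
  let _ : NormedAlgebra ℚ B := NormedAlgebra.restrictScalars ℚ ℝ B
  rw [e1, exp_add, e2, Algebra.algebraMap_eq_smul_one, mul_smul_comm, mul_one, norm_smul,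
    Real.norm_of_nonneg (Real.exp_pos _).le]
  calc _ ≤ Real.exp (-(t * r)) * Real.exp ‖(t * r) • c‖ := by
        gcongr; exact norm_exp_le_exp_norm h1 _
    _ ≤ Real.exp (-(t * r)) * Real.exp (t * r) := by
        gcongr
        rw [norm_smul, Real.norm_of_nonneg (by positivity)]
        exact mul_le_of_le_one_right (by positivity) hc
    _ = 1 := by rw [← Real.exp_add]; simp

/-- Differentiate the path `exp (r a) exp ((t - r) b) c` joining the two exponentials. The factor
`c` is kept because `(a - b) c` can be small when `a - b` is not. -/
theorem norm_exp_smul_sub_exp_smul_mul_le {a b : B} (ha : ∀ t : ℝ, 0 ≤ t → ‖exp (t • a)‖ ≤ 1)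
    (hb : ∀ t : ℝ, 0 ≤ t → ‖exp (t • b)‖ ≤ 1) (c : B) {t : ℝ} (ht : 0 ≤ t) :
    ‖(exp (t • a) - exp (t • b)) * c‖ ≤ ‖(a - b) * c‖ * t := by
  have key := norm_image_sub_le_of_norm_deriv_le_segment' (a := 0) (b := t)
    (f := fun r : ℝ => exp (r • a) * exp ((t - r) • b) * c)
    (f' := fun r : ℝ => exp (r • a) * exp ((t - r) • b) * ((a - b) * c))
    (C := ‖(a - b) * c‖)
    (fun r _ => by
      have h1 := hasDerivAt_exp_smul_const (𝕂 := ℝ) a r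
      have h2 := (hasDerivAt_exp_smul_const (𝕂 := ℝ) b (t - r)).scomp r
        ((hasDerivAt_id r).const_sub t)
      have h3 := (h1.mul h2).mul_const c
      refine HasDerivAt.hasDerivWithinAt ?_
      refine h3.congr_deriv ?_
      simp only [Function.comp_apply, neg_smul, one_smul]
      ring)
    (fun r hr => by
      calc _ ≤ ‖exp (r • a)‖ * ‖exp ((t - r) • b)‖ * ‖(a - b) * c‖ :=
            (norm_mul_le _ _).trans (by gcongr; exact norm_mul_le _ _)
        _ ≤ 1 * 1 * ‖(a - b) * c‖ := by
            gcongr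
            · exact ha r hr.1
            · exact hb _ (sub_nonneg.2 hr.2.le)
        _ = _ := by ring)
    t ⟨ht, le_rfl⟩
  have e : (exp (t • a) - exp (t • b)) * c =
      exp (t • a) * exp ((t - t) • b) * c - exp ((0 : ℝ) • a) * exp ((t - 0) • b) * c := by
    simp [exp_zero, sub_mul]
  rw [e]
  simpa using key

end Exponential

/-! ### Integrated semigroups with bounded generator. -/

section IntegratedExponential

open NormedSpace

variable {B : Type*} [NormedCommRing B] [NormedAlgebra ℝ B]

/-- The integrated semigroup `t ↦ ∫₀ᵗ exp (r a) dr` of a bounded generator `a`. -/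
noncomputable def integratedExp (a : B) (t : ℝ) : B := ∫ r in (0 : ℝ)..t, exp (r • a)

@[simp] theorem integratedExp_zero (a : B) : integratedExp a 0 = 0 := by simp [integratedExp]

variable [CompleteSpace B]

theorem intervalIntegral_mul_const_of_continuous {f : ℝ → B} (hf : Continuous f) (a : B)
    (s t : ℝ) : ∫ r in s..t, f r * a = (∫ r in s..t, f r) * a :=
  ((ContinuousLinearMap.mul ℝ B).flip a).intervalIntegral_comp_comm (hf.intervalIntegrable s t)

theorem continuous_exp_smul_const (a : B) : Continuous fun r : ℝ => exp (r • a) :=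
  continuous_iff_continuousAt.2 fun r => (hasDerivAt_exp_smul_const (𝕂 := ℝ) a r).continuousAt

theorem hasDerivAt_integratedExp (a : B) (t : ℝ) :
    HasDerivAt (integratedExp a) (exp (t • a)) t :=
  intervalIntegral.integral_hasDerivAt_right ((continuous_exp_smul_const a).intervalIntegrable _ _)
    ((continuous_exp_smul_const a).stronglyMeasurableAtFilter _ _)
    (continuous_exp_smul_const a).continuousAt

theorem continuous_integratedExp (a : B) : Continuous (integratedExp a) :=
  continuous_iff_continuousAt.2 fun t => (hasDerivAt_integratedExp a t).continuousAt

theorem integratedExp_mul (a : B) (t : ℝ) : integratedExp a t * a = exp (t • a) - 1 := by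
  have h := intervalIntegral.integral_eq_sub_of_hasDerivAt (a := 0) (b := t)
    (fun r _ => hasDerivAt_exp_smul_const (𝕂 := ℝ) a r)
    (((continuous_exp_smul_const a).mul continuous_const).intervalIntegrable _ _)
  rw [intervalIntegral_mul_const_of_continuous (continuous_exp_smul_const a)] at h
  simpa [integratedExp, exp_zero] using h

theorem integral_integratedExp_mul (a : B) (t : ℝ) :
    (∫ r in (0 : ℝ)..t, integratedExp a r) * a = integratedExp a t - t • 1 := by
  rw [← intervalIntegral_mul_const_of_continuous (continuous_integratedExp a)]
  simp_rw [integratedExp_mul]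
  rw [intervalIntegral.integral_sub ((continuous_exp_smul_const a).intervalIntegrable _ _)
    (continuous_const.intervalIntegrable _ _)]
  simp [integratedExp]

theorem norm_integratedExp_sub_le {a : B} (ha : ∀ t : ℝ, 0 ≤ t → ‖exp (t • a)‖ ≤ 1) {s t : ℝ}
    (hs : 0 ≤ s) (ht : 0 ≤ t) : ‖integratedExp a t - integratedExp a s‖ ≤ |t - s| := by
  have := (convex_Ici (0 : ℝ)).norm_image_sub_le_of_norm_hasDerivWithin_le (C := 1)
    (fun r _ => (hasDerivAt_integratedExp a r).hasDerivWithinAt) (fun r hr => ha r hr) hs ht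
  simpa using this

theorem norm_integratedExp_le {a : B} (ha : ∀ t : ℝ, 0 ≤ t → ‖exp (t • a)‖ ≤ 1) {t : ℝ}
    (ht : 0 ≤ t) : ‖integratedExp a t‖ ≤ t := by
  simpa [abs_of_nonneg ht] using norm_integratedExp_sub_le ha le_rfl ht

/-- The resolvent of `a` at `l`, written as the Laplace transform of the integrated semigroup. -/
noncomputable def laplaceResolvent (a : B) (l : ℝ) : B :=
  l • ∫ t in Ioi (0 : ℝ), Real.exp (-(l * t)) • integratedExp a t

theorem norm_smul_laplaceResolvent_le {a : B} (ha : ∀ t : ℝ, 0 ≤ t → ‖exp (t • a)‖ ≤ 1) {l : ℝ}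
    (hl : 0 < l) : ‖l • laplaceResolvent a l‖ ≤ 1 :=
  norm_smul_integral_exp_neg_smul_le hl fun t ht => by
    simpa using norm_integratedExp_le ha ht

theorem smul_laplaceResolvent_sub_mul {a : B} (ha : ∀ t : ℝ, 0 ≤ t → ‖exp (t • a)‖ ≤ 1) {l : ℝ}
    (hl : 0 < l) : l • laplaceResolvent a l - laplaceResolvent a l * a = 1 := by
  have hs : ∀ t : ℝ, 0 ≤ t → ‖integratedExp a t‖ ≤ 1 * (1 + t ^ 2) := fun t ht => by
    nlinarith [norm_integratedExp_le ha ht, sq_nonneg (t - 1)]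
  have he : ∀ t : ℝ, 0 ≤ t → ‖exp (t • a)‖ ≤ 1 * (1 + t ^ 2) := fun t ht => by
    nlinarith [ha t ht, sq_nonneg t]
  have h1 := smul_integral_exp_neg_smul_eq hl (integratedExp_zero a)
    (continuous_integratedExp a).continuousOn (continuous_exp_smul_const a).continuousOn
    (fun t _ => hasDerivAt_integratedExp a t) hs he
  have i0 := integrableOn_exp_neg_smul hl (continuous_integratedExp a).continuousOn hs
  have i1 := integrableOn_exp_neg_smul hl (continuous_exp_smul_const a).continuousOn he
  have i2 : IntegrableOn (fun t => Real.exp (-(l * t)) • (1 : B)) (Ioi 0) :=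
    integrableOn_exp_neg_smul (C := ‖(1 : B)‖) hl continuousOn_const
      (fun t _ => by nlinarith [norm_nonneg (1 : B), sq_nonneg t])
  have h2 : (∫ t in Ioi (0 : ℝ), Real.exp (-(l * t)) • integratedExp a t) * a =
      (∫ t in Ioi (0 : ℝ), Real.exp (-(l * t)) • exp (t • a)) - l⁻¹ • 1 := by
    refine (((ContinuousLinearMap.mul ℝ B).flip a).integral_comp_comm i0).symm.trans ?_
    simp_rw [ContinuousLinearMap.flip_apply, ContinuousLinearMap.mul_apply', smul_mul_assoc, integratedExp_mul, smul_sub]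
    rw [integral_sub i1 i2, integral_smul_const, integral_exp_neg_mul_Ioi_zero hl]
  rw [← h1] at h2
  unfold laplaceResolvent
  rw [smul_mul_assoc, h2, smul_sub, smul_smul l l⁻¹, mul_inv_cancel₀ hl.ne', one_smul]
  abel

/-- Multiply `s (1 - a) = s - exp (t a) + 1` by `(1 - a)⁻¹`. This writes `s` as a bounded factor
times a resolvent, so norm convergence of resolvents can be transferred to `s`. -/
theorem integratedExp_eq_mul_laplaceResolvent {a : B} (ha : ∀ t : ℝ, 0 ≤ t → ‖exp (t • a)‖ ≤ 1)
    (t : ℝ) : integratedExp a t =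
      (integratedExp a t - exp (t • a) + 1) * laplaceResolvent a 1 := by
  have h1 := smul_laplaceResolvent_sub_mul ha one_pos
  have h2 := integratedExp_mul a t
  rw [one_smul] at h1
  linear_combination (-integratedExp a t) * h1 - laplaceResolvent a 1 * h2

end IntegratedExponential

/-- A pseudo-resolvent on `(0, ∞)` whose values satisfy the contraction estimate. -/
structure IsContractionResolvent {B : Type*} [NormedRing B] [NormedSpace ℝ B] (R : ℝ → B) :
    Prop where
  sub_eq : ∀ l m : ℝ, 0 < l → 0 < m → R l - R m = (m - l) • (R l * R m)
  norm_le : ∀ l : ℝ, 0 < l → ‖l • R l‖ ≤ 1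

/-! ### Norm convergence of the Yosida approximation. -/

namespace IsContractionResolvent

open NormedSpace

variable {B : Type*} [NormedCommRing B] [NormedAlgebra ℝ B] {R : ℝ → B}

/-- The Yosida approximation of the generator of a pseudo-resolvent. -/
def yosida (R : ℝ → B) (n : ℝ) : B := n • (n • R n - 1)

theorem norm_smul_sub_one_le (h1 : ‖(1 : B)‖ ≤ 1) (hR : IsContractionResolvent R) {l : ℝ}
    (hl : 0 < l) : ‖l • R l - 1‖ ≤ 2 :=
  (norm_sub_le _ _).trans (by linarith [hR.norm_le l hl])

theorem norm_apply_le (hR : IsContractionResolvent R) {l : ℝ} (hl : 0 < l) :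
    ‖R l‖ ≤ 1 / l := by
  have := hR.norm_le l hl
  rw [norm_smul, Real.norm_of_nonneg hl.le] at this
  rw [le_div_iff₀ hl]
  linarith

theorem norm_one_sub_one_le (h1 : ‖(1 : B)‖ ≤ 1) (hR : IsContractionResolvent R) :
    ‖R 1 - 1‖ ≤ 2 := by
  simpa using hR.norm_smul_sub_one_le h1 one_pos

theorem smul_sub_one_mul_eq (hR : IsContractionResolvent R) {n m : ℝ} (hn : 0 < n) (hm : 0 < m) :
    (n • R n - 1) * R m = R n * (m • R m - 1) := by
  have h := hR.sub_eq n m hn hm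
  simp only [Algebra.smul_def, map_sub] at h ⊢
  linear_combination h

theorem yosida_mul_eq (hR : IsContractionResolvent R) {n m : ℝ} (hn : 0 < n) (hm : 0 < m) :
    yosida R n * R m = n • R n * (m • R m - 1) := by
  rw [yosida, smul_mul_assoc, hR.smul_sub_one_mul_eq hn hm, smul_mul_assoc]

/-- The resolvent identity moves the factor `R n`, of norm at most `1 / n`, to the front. Thus `n R
n` tends to the identity in norm after multiplication by any `R m`. -/
theorem norm_smul_sub_one_mul_le (h1 : ‖(1 : B)‖ ≤ 1) (hR : IsContractionResolvent R) {n m : ℝ}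
    (hn : 0 < n) (hm : 0 < m) : ‖(n • R n - 1) * R m‖ ≤ 2 / n := by
  rw [hR.smul_sub_one_mul_eq hn hm]
  calc _ ≤ ‖R n‖ * ‖m • R m - 1‖ := norm_mul_le _ _
    _ ≤ 1 / n * 2 := by
      gcongr
      · exact hR.norm_apply_le hn
      · exact hR.norm_smul_sub_one_le h1 hm
    _ = 2 / n := by ring

variable [CompleteSpace B]

theorem norm_exp_smul_yosida_le (h1 : ‖(1 : B)‖ ≤ 1) (hR : IsContractionResolvent R) {n : ℝ}
    (hn : 0 < n) : ∀ t : ℝ, 0 ≤ t → ‖exp (t • yosida R n)‖ ≤ 1 := fun _ ht =>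
  norm_exp_smul_sub_one_le_one h1 (hR.norm_le n hn) hn.le ht

theorem norm_laplaceResolvent_yosida_sub_le (h1 : ‖(1 : B)‖ ≤ 1) (hR : IsContractionResolvent R)
    {n l : ℝ} (hn : 0 < n) (hl : 0 < l) :
    ‖laplaceResolvent (yosida R n) l - R l‖ ≤ 4 / n := by
  have ha := hR.norm_exp_smul_yosida_le h1 hn
  have e1 := smul_laplaceResolvent_sub_mul ha hl
  have e2 := hR.yosida_mul_eq hn hl
  have e3 := norm_smul_laplaceResolvent_le ha hl
  set J := laplaceResolvent (yosida R n) l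
  -- With `a` the Yosida approximation, `(l - a) R l = 1 - n⁻¹ a (l R l - 1)`; multiply by `J` and
  -- use `J a = l J - 1`.
  have e : J - R l = n⁻¹ • ((l • J - 1) * (l • R l - 1)) := by
    have hn' : algebraMap ℝ B n⁻¹ * algebraMap ℝ B n = 1 := by
      rw [← map_mul, inv_mul_cancel₀ hn.ne', map_one]
    have e4 : yosida R n = n • (n • R n - 1) := rfl
    simp only [Algebra.smul_def] at e1 e2 e4 ⊢
    set L := algebraMap ℝ B l
    set N := algebraMap ℝ B n
    set M := algebraMap ℝ B n⁻¹
    linear_combination (R l - M * (L * R l - 1)) * e1 + J * e2 - M * J * (L * R l - 1) * e4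
      - J * (N * R n - 1) * (L * R l - 1) * hn'
  rw [e, norm_smul, Real.norm_of_nonneg (by positivity)]
  have e5 : ‖l • J - 1‖ ≤ 2 := (norm_sub_le _ _).trans (by linarith)
  calc _ ≤ n⁻¹ * (‖l • J - 1‖ * ‖l • R l - 1‖) := by gcongr; exact norm_mul_le _ _
    _ ≤ n⁻¹ * (2 * 2) := by
      gcongr
      exact hR.norm_smul_sub_one_le h1 hl
    _ = 4 / n := by ring

theorem norm_exp_smul_yosida_sub_mul_le (h1 : ‖(1 : B)‖ ≤ 1) (hR : IsContractionResolvent R)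
    {n m p t : ℝ} (hp : 1 ≤ p) (hn : p ^ 2 ≤ n) (hm : p ^ 2 ≤ m) (ht : 0 ≤ t) :
    ‖(exp (t • yosida R n) - exp (t • yosida R m)) * R 1‖ ≤ (4 + 8 * t) / p := by
  have hp0 : 0 < p := by linarith
  have hn0 : 0 < n := lt_of_lt_of_le (by positivity) hn
  have hm0 : 0 < m := lt_of_lt_of_le (by positivity) hm
  have ha := hR.norm_exp_smul_yosida_le h1 hn0
  have hb := hR.norm_exp_smul_yosida_le h1 hm0
  have hD : ‖exp (t • yosida R n) - exp (t • yosida R m)‖ ≤ 2 :=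
    (norm_sub_le _ _).trans (by linarith [ha t ht, hb t ht])
  have h3 := norm_exp_smul_sub_exp_smul_mul_le ha hb (p • R p * R 1) ht
  set D := exp (t • yosida R n) - exp (t • yosida R m)
  -- Replacing `R 1` by the smoother `p R p R 1` costs `O(1 / p)`. On the smoother element the
  -- generators differ by `p · O(1 / p ^ 2)`, which is why `n` and `m` must be at least `p ^ 2`.
  have e1 : D * R 1 = D * (p • R p * R 1) - D * ((p • R p - 1) * R 1) := by ring
  have e2 : (yosida R n - yosida R m) * (p • R p * R 1) =
      p • (((n • R n - 1) * R p - (m • R m - 1) * R p) * (R 1 - 1)) := by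
    have en := hR.yosida_mul_eq hn0 one_pos
    have em := hR.yosida_mul_eq hm0 one_pos
    simp only [Algebra.smul_def, map_one, one_mul] at en em ⊢
    linear_combination (algebraMap ℝ B p * R p) * (en - em)
  have h4 : ‖(yosida R n - yosida R m) * (p • R p * R 1)‖ ≤ 8 / p := by
    rw [e2, norm_smul, Real.norm_of_nonneg hp0.le]
    have h5 : ‖(n • R n - 1) * R p - (m • R m - 1) * R p‖ ≤ 4 / p ^ 2 :=
      calc _ ≤ 2 / n + 2 / m := (norm_sub_le _ _).trans
            (add_le_add (hR.norm_smul_sub_one_mul_le h1 hn0 hp0)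
              (hR.norm_smul_sub_one_mul_le h1 hm0 hp0))
        _ ≤ 2 / p ^ 2 + 2 / p ^ 2 := by gcongr
        _ = 4 / p ^ 2 := by ring
    calc _ ≤ p * (4 / p ^ 2 * 2) := by
          gcongr
          refine (norm_mul_le _ _).trans ?_
          gcongr
          exact hR.norm_one_sub_one_le h1
      _ = 8 / p := by field_simp; norm_num
  have h6 : ‖D * ((p • R p - 1) * R 1)‖ ≤ 2 * (2 / p) := by
    refine (norm_mul_le _ _).trans ?_
    gcongr
    exact hR.norm_smul_sub_one_mul_le h1 hp0 one_pos
  rw [e1]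
  calc _ ≤ ‖D * (p • R p * R 1)‖ + ‖D * ((p • R p - 1) * R 1)‖ := norm_sub_le _ _
    _ ≤ 8 / p * t + 2 * (2 / p) := by
      refine add_le_add (h3.trans ?_) h6
      gcongr
    _ = (4 + 8 * t) / p := by ring

theorem norm_integratedExp_yosida_sub_le (h1 : ‖(1 : B)‖ ≤ 1) (hR : IsContractionResolvent R)
    {n m p t : ℝ} (hp : 1 ≤ p) (hn : p ^ 2 ≤ n) (hm : p ^ 2 ≤ m) (ht : 0 ≤ t) :
    ‖integratedExp (yosida R n) t - integratedExp (yosida R m) t‖ ≤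
      ((1 + t) * (4 + 8 * t) + 8 * (t + 2)) / p := by
  have hp0 : 0 < p := by linarith
  have hn0 : 0 < n := lt_of_lt_of_le (by positivity) hn
  have hm0 : 0 < m := lt_of_lt_of_le (by positivity) hm
  have ha := hR.norm_exp_smul_yosida_le h1 hn0
  have hb := hR.norm_exp_smul_yosida_le h1 hm0
  have hsn := integratedExp_eq_mul_laplaceResolvent ha t
  have hsm := integratedExp_eq_mul_laplaceResolvent hb t
  have hA := hR.norm_exp_smul_yosida_sub_mul_le h1 hp hn hm ht
  have hB : ‖(integratedExp (yosida R n) t - integratedExp (yosida R m) t) * R 1‖ ≤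
      (4 + 8 * t) / p * t := by
    have key := norm_image_sub_le_of_norm_deriv_le_segment' (a := 0) (b := t)
      (f := fun r => (integratedExp (yosida R n) r - integratedExp (yosida R m) r) * R 1)
      (fun r _ => (((hasDerivAt_integratedExp (yosida R n) r).sub
        (hasDerivAt_integratedExp (yosida R m) r)).mul_const (R 1)).hasDerivWithinAt)
      (C := (4 + 8 * t) / p)
      (fun r hr => (hR.norm_exp_smul_yosida_sub_mul_le h1 hp hn hm hr.1).trans (by
        gcongr; exact hr.2.le)) t ⟨ht, le_rfl⟩
    simpa using key
  have hC : ∀ q : ℝ, p ^ 2 ≤ q → ‖(integratedExp (yosida R q) t - exp (t • yosida R q) + 1) *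
      (laplaceResolvent (yosida R q) 1 - R 1)‖ ≤ (t + 2) * (4 / p) := fun q hq => by
    have hq0 : 0 < q := lt_of_lt_of_le (by positivity) hq
    have hc := hR.norm_exp_smul_yosida_le h1 hq0
    have hpq : p ≤ q := le_trans (by nlinarith) hq
    refine (norm_mul_le _ _).trans ?_
    gcongr
    · refine (norm_add_le _ _).trans ?_
      have := norm_sub_le (integratedExp (yosida R q) t) (exp (t • yosida R q))
      linarith [norm_integratedExp_le hc ht, hc t ht]
    · exact (hR.norm_laplaceResolvent_yosida_sub_le h1 hq0 one_pos).trans (by gcongr)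
  -- Subtract the identities `s = (s - exp + 1) J` for `n` and `m` and split each `J` as `R 1 + (J -
  -- R 1)`; the constant terms `R 1` cancel.
  have e : integratedExp (yosida R n) t - integratedExp (yosida R m) t =
      ((integratedExp (yosida R n) t - integratedExp (yosida R m) t) * R 1 -
        (exp (t • yosida R n) - exp (t • yosida R m)) * R 1) +
      ((integratedExp (yosida R n) t - exp (t • yosida R n) + 1) *
        (laplaceResolvent (yosida R n) 1 - R 1) -
      (integratedExp (yosida R m) t - exp (t • yosida R m) + 1) *
        (laplaceResolvent (yosida R m) 1 - R 1)) := by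
    linear_combination hsn - hsm
  rw [e]
  refine (norm_add_le _ _).trans ((add_le_add (norm_sub_le _ _) (norm_sub_le _ _)).trans ?_)
  calc _ ≤ ((4 + 8 * t) / p * t + (4 + 8 * t) / p) + ((t + 2) * (4 / p) + (t + 2) * (4 / p)) :=
        add_le_add (add_le_add hB hA) (add_le_add (hC n hn) (hC m hm))
    _ = _ := by ring

theorem exists_tendsto_integratedExp_yosida (h1 : ‖(1 : B)‖ ≤ 1) (hR : IsContractionResolvent R)
    {t : ℝ} (ht : 0 ≤ t) :
    ∃ s : B, Tendsto (fun k : ℕ => integratedExp (yosida R (((k : ℝ) + 1) ^ 2)) t)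
      atTop (𝓝 s) := by
  refine cauchySeq_tendsto_of_complete (cauchySeq_of_le_tendsto_0
    (fun k : ℕ => ((1 + t) * (4 + 8 * t) + 8 * (t + 2)) * (1 / ((k : ℝ) + 1))) ?_ ?_)
  · intro n m k hn hm
    rw [dist_eq_norm, mul_one_div]
    have hn' : (k : ℝ) ≤ n := by exact_mod_cast hn
    have hm' : (k : ℝ) ≤ m := by exact_mod_cast hm
    exact hR.norm_integratedExp_yosida_sub_le h1 (by linarith [k.cast_nonneg (α := ℝ)])
      (by gcongr) (by gcongr) ht
  · simpa using tendsto_one_div_add_atTop_nhds_zero_nat.const_mul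
      ((1 + t) * (4 + 8 * t) + 8 * (t + 2))

/-- A contractive pseudo-resolvent is the Laplace transform of an integrated semigroup. -/
theorem exists_integratedSemigroup (h1 : ‖(1 : B)‖ ≤ 1) (hR : IsContractionResolvent R) :
    ∃ S : ℝ → B, S 0 = 0 ∧ (∀ s t : ℝ, 0 ≤ s → 0 ≤ t → ‖S t - S s‖ ≤ |t - s|) ∧
      (∀ l : ℝ, 0 < l → l • ∫ t in Ioi (0 : ℝ), Real.exp (-(l * t)) • S t = R l) ∧
      ∀ t : ℝ, 0 ≤ t → ∫ r in (0 : ℝ)..t, S r = R 1 * ((∫ r in (0 : ℝ)..t, S r) - S t + t • 1) := by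
  choose! S hS using fun t : ℝ => hR.exists_tendsto_integratedExp_yosida h1 (t := t)
  -- The square meets the requirement `p ^ 2 ≤ n` of the Cauchy estimate with `p = k + 1`.
  let N : ℕ → ℝ := fun k => ((k : ℝ) + 1) ^ 2
  have hN : ∀ k, 0 < N k := fun k => by positivity
  have hNtop : Tendsto N atTop atTop :=
    (tendsto_pow_atTop two_ne_zero).comp
      (tendsto_atTop_add_const_right _ _ tendsto_natCast_atTop_atTop)
  have ha : ∀ k, ∀ t : ℝ, 0 ≤ t → ‖exp (t • yosida R (N k))‖ ≤ 1 :=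
    fun k => hR.norm_exp_smul_yosida_le h1 (hN k)
  have hJ : ∀ l : ℝ, 0 < l →
      Tendsto (fun k => laplaceResolvent (yosida R (N k)) l) atTop (𝓝 (R l)) := fun l hl => by
    refine tendsto_iff_norm_sub_tendsto_zero.2 (squeeze_zero (fun _ => norm_nonneg _)
      (fun k => hR.norm_laplaceResolvent_yosida_sub_le h1 (hN k) hl) ?_)
    exact hNtop.const_div_atTop 4
  have hW : ∀ t : ℝ, 0 ≤ t → Tendsto (fun k => ∫ r in (0 : ℝ)..t, integratedExp (yosida R (N k)) r)
      atTop (𝓝 (∫ r in (0 : ℝ)..t, S r)) := fun t ht => by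
    refine intervalIntegral.tendsto_integral_filter_of_dominated_convergence (fun r => r)
      (Eventually.of_forall fun k => (continuous_integratedExp _).aestronglyMeasurable)
      (Eventually.of_forall fun k => Eventually.of_forall fun r hr => ?_)
      (continuous_id.intervalIntegrable _ _)
      (Eventually.of_forall fun r hr => ?_) <;> rw [uIoc_of_le ht] at hr
    · exact norm_integratedExp_le (ha k) hr.1.le
    · exact hS r hr.1.le
  refine ⟨S, ?_, fun s t hs ht => ?_, fun l hl => ?_, fun t ht => ?_⟩
  · exact tendsto_nhds_unique (hS 0 le_rfl) (by simp)
  · exact le_of_tendsto ((hS t ht).sub (hS s hs)).norm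
      (Eventually.of_forall fun k => norm_integratedExp_sub_le (ha k) hs ht)
  · refine tendsto_nhds_unique ?_ (hJ l hl)
    refine (tendsto_integral_exp_neg_smul (C := 1) hl
      (fun k => (continuous_integratedExp _).continuousOn) (fun k t ht => ?_) hS).const_smul l
    nlinarith [norm_integratedExp_le (ha k) ht, sq_nonneg (t - 1)]
  · refine tendsto_nhds_unique (hW t ht) (((hJ 1 one_pos).mul
      (((hW t ht).sub (hS t ht)).add_const (t • 1))).congr fun k => ?_)
    have e1 := smul_laplaceResolvent_sub_mul (ha k) one_pos
    have e2 := integral_integratedExp_mul (yosida R (N k)) t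
    rw [one_smul] at e1
    linear_combination (∫ r in (0 : ℝ)..t, integratedExp (yosida R (N k)) r) * e1 +
      laplaceResolvent (yosida R (N k)) 1 * e2

end IsContractionResolvent

/-- The version of `exists_integratedSemigroup` without commutativity of the ambient algebra. -/
theorem IsContractionResolvent.exists_integratedSemigroup_of_normedRing {B : Type*} [NormedRing B]
    [NormedAlgebra ℝ B] [CompleteSpace B] {R : ℝ → B} (h1 : ‖(1 : B)‖ ≤ 1)
    (hR : IsContractionResolvent R) :
    ∃ S : ℝ → B, S 0 = 0 ∧ (∀ s t : ℝ, 0 ≤ s → 0 ≤ t → ‖S t - S s‖ ≤ |t - s|) ∧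
      (∀ l : ℝ, 0 < l → l • ∫ t in Ioi (0 : ℝ), Real.exp (-(l * t)) • S t = R l) ∧
      ∀ t : ℝ, 0 ≤ t → ∫ r in (0 : ℝ)..t, S r = R 1 * ((∫ r in (0 : ℝ)..t, S r) - S t + t • 1) := by
  have hcomm : ∀ x ∈ R '' Ioi 0, ∀ y ∈ R '' Ioi 0, x * y = y * x := by
    rintro _ ⟨l, hl, rfl⟩ _ ⟨m, hm, rfl⟩
    rcases eq_or_ne l m with rfl | hlm
    · rfl
    · have e1 := hR.sub_eq l m hl hm
      have e2 := hR.sub_eq m l hm hl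
      have e3 : (m - l) • (R l * R m - R m * R l) = 0 := by
        calc _ = (m - l) • (R l * R m) + (l - m) • (R m * R l) := by module
          _ = 0 := by rw [← e1, ← e2]; abel
      exact sub_eq_zero.1 ((smul_eq_zero.1 e3).resolve_left (sub_ne_zero.2 hlm.symm))
  -- The resolvents commute, so the closed subalgebra they generate is commutative and complete. The
  -- commutative case applies there, and its inclusion commutes with the integrals.
  let A₀ := Algebra.adjoin ℝ (R '' Ioi 0)
  have hA₀ : IsMulCommutative A₀ := Algebra.isMulCommutative_adjoin ℝ hcomm
  let K := A₀.topologicalClosure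
  have hK : IsClosed (K : Set B) := A₀.isClosed_topologicalClosure
  have hmul : ∀ x y : K, x * y = y * x :=
    (A₀.commRingTopologicalClosure fun x y => mul_comm' x y).mul_comm
  let _ : NormedCommRing K := { K.normedRing with mul_comm := hmul }
  have : CompleteSpace K := hK.completeSpace_coe
  have hmem : ∀ l : ℝ, 0 < l → R l ∈ K := fun l hl =>
    A₀.le_topologicalClosure (Algebra.subset_adjoin ⟨l, hl, rfl⟩)
  let R' : ℝ → K := fun l => if h : 0 < l then ⟨R l, hmem l h⟩ else 0
  have hR'c : ∀ l : ℝ, 0 < l → (R' l : B) = R l := fun l hl => by simp [R', hl]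
  have hR' : IsContractionResolvent R' :=
    ⟨fun l m hl hm => Subtype.ext (by simpa [hR'c, hl, hm] using hR.sub_eq l m hl hm),
      fun l hl => by
        have := hR.norm_le l hl
        rw [← hR'c l hl] at this
        exact this⟩
  obtain ⟨S, S0, SL, SR, SW⟩ := hR'.exists_integratedSemigroup h1
  have hcont : ContinuousOn S (Ici 0) := by
    refine (LipschitzOnWith.of_dist_le_mul (K := 1) fun t ht s hs => ?_).continuousOn
    simpa [dist_eq_norm] using SL s t hs ht
  let ι : K →L[ℝ] B := K.toSubmodule.subtypeL
  have hW : ∀ t : ℝ, 0 ≤ t → ∫ r in (0 : ℝ)..t, (S r : B) = ((∫ r in (0 : ℝ)..t, S r : K) : B) :=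
    fun t ht => ι.intervalIntegral_comp_comm
      ((hcont.mono (by rw [uIcc_of_le ht]; exact Icc_subset_Ici_self)).intervalIntegrable)
  refine ⟨fun t => S t, by simp [S0], fun s t hs ht => SL s t hs ht, fun l hl => ?_,
    fun t ht => ?_⟩
  · have hi : IntegrableOn (fun t => Real.exp (-(l * t)) • S t) (Ioi 0) :=
      integrableOn_exp_neg_smul (C := 1) hl hcont fun t ht => by
        have := SL 0 t le_rfl ht
        simp only [S0, sub_zero, abs_of_nonneg ht] at this
        nlinarith [sq_nonneg (t - 1)]
    rw [← hR'c l hl, ← SR l hl]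
    exact congrArg (l • ·) (ι.integral_comp_comm hi)
  · rw [hW t ht, ← hR'c 1 one_pos]
    exact congrArg Subtype.val (SW t ht)

/-! ### Injectivity of the Laplace transform. -/

section Lerch

variable {E : Type*} [NormedAddCommGroup E] [NormedSpace ℝ E]

theorem integrableOn_exp_neg_mul_comp_smul {f : ℝ → E} {C : ℝ} (hf : ContinuousOn f (Ici 0))
    (hC : ∀ t, 0 ≤ t → ‖f t‖ ≤ C * (1 + t ^ 2)) {g : ℝ → ℝ} (hg : ContinuousOn g (Icc 0 1)) :
    IntegrableOn (fun t => (Real.exp (-t) * g (Real.exp (-t))) • f t) (Ioi 0) := by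
  obtain ⟨M, hM⟩ := isCompact_Icc.exists_bound_of_continuousOn hg
  have hmaps : ∀ t : ℝ, 0 < t → Real.exp (-t) ∈ Icc (0 : ℝ) 1 := fun t ht =>
    ⟨(Real.exp_pos _).le, Real.exp_le_one_iff.2 (by linarith)⟩
  have h := integrableOn_exp_neg_smul one_pos hf hC
  refine Integrable.mono' (h.norm.const_mul M) ?_ ?_
  · refine ContinuousOn.aestronglyMeasurable ?_ measurableSet_Ioi
    refine ContinuousOn.smul (ContinuousOn.mul (by fun_prop) ?_) (hf.mono Ioi_subset_Ici_self)
    exact hg.comp (by fun_prop) hmaps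
  · filter_upwards [ae_restrict_mem measurableSet_Ioi] with t ht
    rw [norm_smul, norm_smul, norm_mul, one_mul]
    have := hM _ (hmaps t ht)
    nlinarith [mul_le_mul_of_nonneg_left this
      (mul_nonneg (norm_nonneg (Real.exp (-t))) (norm_nonneg (f t)))]

/-- In the variable `x = exp (-t)` the hypothesis at `l = n + 1` kills the monomial `x ^ n`;
Weierstrass approximation passes from polynomials to continuous `g`. -/
theorem integral_exp_neg_mul_comp_smul_eq_zero [CompleteSpace E] {f : ℝ → E} {C : ℝ}
    (hf : ContinuousOn f (Ici 0)) (hC : ∀ t, 0 ≤ t → ‖f t‖ ≤ C * (1 + t ^ 2))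
    (h0 : ∀ l : ℝ, 0 < l → ∫ t in Ioi (0 : ℝ), Real.exp (-(l * t)) • f t = 0) {g : ℝ → ℝ}
    (hg : ContinuousOn g (Icc 0 1)) :
    ∫ t in Ioi (0 : ℝ), (Real.exp (-t) * g (Real.exp (-t))) • f t = 0 := by
  have hpoly : ∀ p : Polynomial ℝ,
      ∫ t in Ioi (0 : ℝ), (Real.exp (-t) * p.eval (Real.exp (-t))) • f t = 0 := by
    intro p
    induction p using Polynomial.induction_on' with
    | add p q hp hq =>
      have hpi := integrableOn_exp_neg_mul_comp_smul hf hC p.continuous.continuousOn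
      have hqi := integrableOn_exp_neg_mul_comp_smul hf hC q.continuous.continuousOn
      simp_rw [Polynomial.eval_add, mul_add, add_smul]
      rw [integral_add hpi hqi, hp, hq, add_zero]
    | monomial n c =>
      have hn := h0 (n + 1) (by positivity)
      have : ∀ t : ℝ, (Real.exp (-t) * (Polynomial.monomial n c).eval (Real.exp (-t))) • f t =
          c • (Real.exp (-((n + 1) * t)) • f t) := fun t => by
        rw [Polynomial.eval_monomial, ← Real.exp_nat_mul, smul_smul]
        congr 1
        rw [mul_left_comm, ← Real.exp_add]
        ring_nf
      simp_rw [this]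
      rw [integral_smul, hn, smul_zero]
  have hi := (integrableOn_exp_neg_smul one_pos hf hC).norm
  have hgi := integrableOn_exp_neg_mul_comp_smul hf hC hg
  set I := ∫ t in Ioi (0 : ℝ), ‖Real.exp (-(1 * t)) • f t‖ with hI
  have hI0 : 0 ≤ I := integral_nonneg fun _ => norm_nonneg _
  rw [← norm_le_zero_iff]
  refine le_of_forall_pos_le_add fun ε hε => ?_
  obtain ⟨p, hp⟩ := exists_polynomial_near_of_continuousOn 0 1 g hg (ε / (I + 1)) (by positivity)
  have hpi := integrableOn_exp_neg_mul_comp_smul hf hC p.continuous.continuousOn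
  have e : ∫ t in Ioi (0 : ℝ), (Real.exp (-t) * g (Real.exp (-t))) • f t =
      ∫ t in Ioi (0 : ℝ), ((Real.exp (-t) * g (Real.exp (-t))) • f t -
        (Real.exp (-t) * p.eval (Real.exp (-t))) • f t) := by
    rw [integral_sub hgi hpi, hpoly p, sub_zero]
  rw [e]
  calc _ ≤ ∫ t in Ioi (0 : ℝ), ε / (I + 1) * ‖Real.exp (-(1 * t)) • f t‖ := by
        refine norm_integral_le_of_norm_le (hi.const_mul _) ?_
        filter_upwards [ae_restrict_mem measurableSet_Ioi] with t ht
        have hx : Real.exp (-t) ∈ Icc (0 : ℝ) 1 :=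
          ⟨(Real.exp_pos _).le, Real.exp_le_one_iff.2 (by linarith [mem_Ioi.1 ht])⟩
        rw [← sub_smul, ← mul_sub, norm_smul, norm_smul, norm_mul, one_mul,
          Real.norm_eq_abs (_ - _), abs_sub_comm]
        nlinarith [mul_le_mul_of_nonneg_left (hp _ hx).le
          (mul_nonneg (norm_nonneg (Real.exp (-t))) (norm_nonneg (f t)))]
    _ = ε / (I + 1) * I := by rw [integral_const_mul]
    _ ≤ 0 + ε := by
        rw [zero_add, div_mul_eq_mul_div, div_le_iff₀ (by positivity)]
        nlinarith

/-- A continuous function of polynomial growth with vanishing Laplace transform is zero. -/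
theorem eq_zero_of_laplace_eq_zero [CompleteSpace E] {f : ℝ → E} {C : ℝ}
    (hf : ContinuousOn f (Ici 0)) (hC : ∀ t, 0 ≤ t → ‖f t‖ ≤ C * (1 + t ^ 2))
    (h0 : ∀ l : ℝ, 0 < l → ∫ t in Ioi (0 : ℝ), Real.exp (-(l * t)) • f t = 0) :
    EqOn f 0 (Ioi 0) := by
  have hfI : ContinuousOn f (Ioi 0) := hf.mono Ioi_subset_Ici_self
  have hae := isOpen_Ioi.ae_eq_zero_of_integral_contDiff_smul_eq_zero (μ := volume)
    (hfI.locallyIntegrableOn measurableSet_Ioi) (fun φ hφ hφc hφs => ?_)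
  · refine Measure.eqOn_open_of_ae_eq (μ := volume) ?_ isOpen_Ioi hfI continuousOn_const
    exact (ae_restrict_iff' measurableSet_Ioi).2 hae
  · have hφ0 : ∀ t ≤ 0, φ t = 0 := fun t ht => by
      by_contra h
      exact absurd (hφs (subset_tsupport _ h)) (by simpa using ht)
    obtain ⟨T, hT⟩ : ∃ T : ℝ, ∀ t, T < t → φ t = 0 := by
      obtain ⟨T, hT⟩ := hφc.isCompact.bddAbove
      refine ⟨T, fun t ht => ?_⟩
      by_contra h
      exact absurd (hT (subset_tsupport _ h)) (by simpa using ht)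
    -- This `g` satisfies `exp (-t) g (exp (-t)) = φ t`. It vanishes near 0 because `φ` vanishes
    -- beyond `T`.
    have hg : ContinuousOn (fun x => φ (-Real.log x) / x) (Icc 0 1) := by
      intro x hx
      rcases hx.1.eq_or_lt with rfl | hx0
      · have hev : (fun x => φ (-Real.log x) / x) =ᶠ[𝓝[Icc 0 1] 0] fun _ => 0 := by
          filter_upwards [self_mem_nhdsWithin,
            mem_nhdsWithin_of_mem_nhds (Iio_mem_nhds (Real.exp_pos (-T)))] with y hy hyT
          rcases hy.1.eq_or_lt with rfl | hy0
          · simp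
          · rw [hT _ (by linarith [(Real.log_lt_iff_lt_exp hy0).2 hyT]), zero_div]
        exact continuousWithinAt_const.congr_of_eventuallyEq hev (by simp)
      · refine ContinuousAt.continuousWithinAt ?_
        exact ((hφ.continuous.continuousAt).comp (Real.continuousAt_log hx0.ne').neg).div
          continuousAt_id hx0.ne'
    rw [← integral_exp_neg_mul_comp_smul_eq_zero hf hC h0 hg,
      ← setIntegral_eq_integral_of_forall_compl_eq_zero (s := Ioi 0)]
    · refine setIntegral_congr_fun measurableSet_Ioi fun t _ => ?_
      simp [mul_div_cancel₀, (Real.exp_pos (-t)).ne']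
    · intro t ht
      rw [hφ0 t (by simpa using ht), zero_smul]

end Lerch

/-- The quotient map by `K` is continuous and kills the integrand almost everywhere, hence also the
integral. -/
theorem Submodule.integral_mem_of_isClosed {α E : Type*} [MeasurableSpace α] {μ : Measure α}
    [NormedAddCommGroup E] [NormedSpace ℝ E] [CompleteSpace E] (K : Submodule ℝ E)
    (hK : IsClosed (K : Set E)) {f : α → E} (hf : Integrable f μ) (h : ∀ᵐ a ∂μ, f a ∈ K) :
    ∫ a, f a ∂μ ∈ K := by
  have := hK
  have e := K.mkQL.integral_comp_comm hf
  rw [integral_eq_zero_of_ae] at e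
  · exact (Submodule.Quotient.mk_eq_zero K).1 e.symm
  · filter_upwards [h] with a ha
    exact (Submodule.Quotient.mk_eq_zero K).2 ha

namespace LinRel

/-! ### Resolvents of m-dissipative relations. -/

section Resolvent

variable {𝕜 X : Type*} [RCLike 𝕜] [NormedAddCommGroup X] [NormedSpace 𝕜 X]
  {A : Submodule 𝕜 (X × X)}

theorem isResolventAt_iff {l : 𝕜} {R : X →L[𝕜] X} :
    IsResolventAt A l R ↔ ∀ x y : X, (x, l • x - y) ∈ A ↔ x = R y := by
  have h : ∀ x y : X, (y, x) ∈ inverse (shift l A) ↔ (x, l • x - y) ∈ A := fun x y => by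
    rw [mem_inverse, mem_shift]
    constructor
    · rintro ⟨z, hz, rfl⟩
      simpa using hz
    · exact fun hz => ⟨_, hz, by abel⟩
  simp only [IsResolventAt, Set.ext_iff, Prod.forall, SetLike.mem_coe, Set.mem_ofPred_eq,
    Prod.mk.injEq, h]
  exact ⟨fun H x y => (H y x).trans ⟨by rintro ⟨_, rfl, rfl⟩; rfl, fun e => ⟨y, rfl, e⟩⟩,
    fun H y x => (H x y).trans ⟨fun e => ⟨y, rfl, e⟩, by rintro ⟨_, rfl, rfl⟩; rfl⟩⟩

theorem IsResolventAt.unique {l : 𝕜} {R R' : X →L[𝕜] X} (h : IsResolventAt A l R)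
    (h' : IsResolventAt A l R') : R = R' := by
  ext y
  exact (isResolventAt_iff.1 h' _ _).1 ((isResolventAt_iff.1 h _ _).2 rfl)

theorem ran_shift_eq_top_iff {l : 𝕜} :
    ran (shift l A) = ⊤ ↔ ∀ y : X, ∃ x : X, (x, l • x - y) ∈ A := by
  simp only [Submodule.eq_top_iff', mem_ran, mem_shift]
  refine forall_congr' fun y => exists_congr fun x => ⟨?_, fun h => ⟨_, h, by abel⟩⟩
  rintro ⟨z, hz, rfl⟩
  simpa using hz

theorem Dissipative.exists_isResolventAt (hA : Dissipative A) {l : ℝ} (hl : 0 < l)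
    (hr : ∀ y : X, ∃ x : X, (x, (l : 𝕜) • x - y) ∈ A) :
    ∃ R : X →L[𝕜] X, IsResolventAt A (l : 𝕜) R ∧ ∀ y, l * ‖R y‖ ≤ ‖y‖ := by
  have hle : ∀ x y : X, (x, (l : 𝕜) • x - y) ∈ A → l * ‖x‖ ≤ ‖y‖ := fun x y h => by
    simpa [norm_smul, abs_of_pos hl] using hA _ _ h l hl
  have huniq : ∀ x x' y : X, (x, (l : 𝕜) • x - y) ∈ A → (x', (l : 𝕜) • x' - y) ∈ A → x = x' :=
    fun x x' y h h' => by
      have h0 : (x - x', (l : 𝕜) • (x - x') - 0) ∈ A := by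
        convert A.sub_mem h h' using 1
        rw [Prod.mk_sub_mk, Prod.mk.injEq]
        exact ⟨rfl, by module⟩
      have := hle _ _ h0
      rw [norm_zero] at this
      exact sub_eq_zero.1 (norm_le_zero_iff.1 (nonpos_of_mul_nonpos_right this hl))
  choose r hr using hr
  let L : X →ₗ[𝕜] X :=
    { toFun := r
      map_add' := fun y z => huniq _ _ (y + z) (hr _) (by
        convert A.add_mem (hr y) (hr z) using 1
        rw [Prod.mk_add_mk, Prod.mk.injEq]
        exact ⟨rfl, by module⟩)
      map_smul' := fun c y => huniq _ _ (c • y) (hr _) (by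
        convert A.smul_mem c (hr y) using 1
        rw [Prod.smul_mk, Prod.mk.injEq]
        exact ⟨rfl, by simp only [RingHom.id_apply]; module⟩) }
  refine ⟨L.mkContinuous l⁻¹ fun y => ?_, isResolventAt_iff.2 fun x y => ⟨fun h => ?_, ?_⟩,
    fun y => hle _ _ (hr y)⟩
  · rw [inv_mul_eq_div, le_div_iff₀ hl, mul_comm]
    exact hle _ _ (hr y)
  · exact huniq _ _ y h (hr y)
  · rintro rfl
    exact hr y

/-- Solve `w - (l - m) R w = y` by a Neumann series and take `x = R w`; the series converges because
`|l - m| < l`. -/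
theorem exists_mem_of_isResolventAt [CompleteSpace X] {l m : ℝ} (hl : 0 < l) (hm : 0 < m)
    (hml : m < 2 * l) {R : X →L[𝕜] X} (hR : IsResolventAt A (l : 𝕜) R)
    (hRn : ∀ y, l * ‖R y‖ ≤ ‖y‖) (y : X) : ∃ x : X, (x, (m : 𝕜) • x - y) ∈ A := by
  have hRn' : ‖R‖ ≤ l⁻¹ := R.opNorm_le_bound (by positivity) fun y => by
    rw [inv_mul_eq_div, le_div_iff₀ hl, mul_comm]
    exact hRn y
  have hlt : ‖((l - m : ℝ) : 𝕜) • R‖ < 1 := by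
    rw [norm_smul, RCLike.norm_ofReal]
    calc _ ≤ |l - m| * l⁻¹ := by gcongr
      _ < 1 := by
        rw [← div_eq_mul_inv, div_lt_one hl, abs_lt]
        constructor <;> linarith
  obtain ⟨u, hu⟩ := isUnit_one_sub_of_norm_lt_one hlt
  set w : X := (↑u⁻¹ : X →L[𝕜] X) y
  have hw : w - ((l - m : ℝ) : 𝕜) • R w = y := by
    have : (u : X →L[𝕜] X) w = y := by
      change ((u : X →L[𝕜] X) * (↑u⁻¹ : X →L[𝕜] X)) y = y
      rw [Units.mul_inv]
      rfl
    rw [hu] at this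
    exact this
  refine ⟨R w, ?_⟩
  have := (isResolventAt_iff.1 hR (R w) w).2 rfl
  convert this using 2
  rw [← hw]
  push_cast
  module

theorem MDissipative.exists_isResolventAt [CompleteSpace X] (hA : MDissipative A) {l : ℝ}
    (hl : 0 < l) : ∃ R : X →L[𝕜] X, IsResolventAt A (l : 𝕜) R ∧ ∀ y, l * ‖R y‖ ≤ ‖y‖ := by
  obtain ⟨hd, m, hm, hr⟩ := hA
  rw [ran_shift_eq_top_iff] at hr
  -- Each Neumann step reaches every parameter below twice the current one. Steps by `3 / 2` climb
  -- arbitrarily high, and from high enough a single step reaches `l`.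
  have hpow : ∀ n : ℕ, ∀ y : X, ∃ x : X, (x, ((m * (3 / 2) ^ n : ℝ) : 𝕜) • x - y) ∈ A := by
    intro n
    induction n with
    | zero => simpa using hr
    | succ n ih =>
      have hpos : 0 < m * (3 / 2) ^ n := by positivity
      obtain ⟨R, hR, hRn⟩ := hd.exists_isResolventAt hpos ih
      exact exists_mem_of_isResolventAt hpos (by positivity) (by rw [pow_succ]; linarith) hR hRn
  obtain ⟨n, hn⟩ := pow_unbounded_of_one_lt (l / m) (by norm_num : (1 : ℝ) < 3 / 2)
  rw [div_lt_iff₀ hm] at hn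
  have hpos : 0 < m * (3 / 2) ^ n := by positivity
  obtain ⟨R, hR, hRn⟩ := hd.exists_isResolventAt hpos (hpow n)
  exact hd.exists_isResolventAt hl (exists_mem_of_isResolventAt hpos hl (by linarith) hR hRn)

end Resolvent

/-! ### Mild solutions and the generated integrated semigroup. -/

section Evolution

variable {𝕜 X : Type*} [RCLike 𝕜] [NormedAddCommGroup X] [NormedSpace 𝕜 X]
  [NormedSpace ℝ X] [IsScalarTower ℝ 𝕜 X] {A : Submodule 𝕜 (X × X)}

theorem ofReal_smul (r : ℝ) (x : X) : (r : 𝕜) • x = r • x :=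
  (RCLike.real_smul_eq_coe_smul (K := 𝕜) r x).symm

theorem Dissipative.norm_le_norm_sub_smul (hA : Dissipative A) {x y : X} (hxy : (x, y) ∈ A)
    {h : ℝ} (hh : 0 < h) : ‖x‖ ≤ ‖x - h • y‖ := by
  have := hA x y hxy h⁻¹ (by positivity)
  rw [ofReal_smul, norm_smul, Real.norm_of_nonneg (by positivity)] at this
  have e : x - h • y = h • (h⁻¹ • x - y) := by
    rw [smul_sub, smul_smul, mul_inv_cancel₀ hh.ne', one_smul]
  rw [e, norm_smul, Real.norm_of_nonneg hh.le]
  calc ‖x‖ = h * (h⁻¹ * ‖x‖) := by field_simp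
    _ ≤ _ := by gcongr

/-- A differentiable solution of a dissipative inclusion that starts at zero vanishes. -/
theorem Dissipative.eq_zero_of_hasDerivAt (hA : Dissipative A) {W W' : ℝ → X} (h0 : W 0 = 0)
    (hc : ContinuousOn W (Ici 0)) (hd : ∀ t, 0 < t → HasDerivAt W (W' t) t)
    (hm : ∀ t, 0 < t → (W t, W' t) ∈ A) {T : ℝ} (hT : 0 ≤ T) : W T = 0 := by
  -- Time is run backwards from `T`. Dissipativity gives `‖W τ‖ ≤ ‖W τ - h W' τ‖ ≤ ‖W (τ - h)‖ +
  -- o(h)`, so `-‖W (T - s)‖` cannot increase, and `‖W T‖ ≤ ‖W 0‖ = 0`.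
  have key := image_le_of_liminf_slope_right_le_deriv_boundary (a := 0) (b := T)
    (f := fun s => -‖W (T - s)‖) (B := fun _ => -‖W T‖) (B' := fun _ => 0)
    (by
      refine ContinuousOn.neg (ContinuousOn.norm (hc.comp (by fun_prop) fun s hs => ?_))
      exact sub_nonneg.2 hs.2)
    (by simp) continuousOn_const (fun x _ => hasDerivWithinAt_const _ _ _)
    (fun s hs r hr => by
      have hτ : 0 < T - s := sub_pos.2 hs.2
      have hV : HasDerivAt (fun z => W (T - z)) (-W' (T - s)) s := by
        have := (hd _ hτ).scomp s ((hasDerivAt_id s).const_sub T)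
        simpa [Function.comp_def] using this
      have hV2 : Tendsto (slope (fun z => W (T - z)) s) (𝓝[>] s) (𝓝 (-W' (T - s))) :=
        (hasDerivAt_iff_tendsto_slope.1 hV).mono_left
        (nhdsWithin_mono s fun z (hz : s < z) => hz.ne')
      have hV3 := (hV2.add_const (W' (T - s))).norm
      rw [neg_add_cancel, norm_zero] at hV3
      refine ((hV3.eventually (gt_mem_nhds hr)).and self_mem_nhdsWithin).frequently.mono ?_
      rintro z ⟨hz, hsz⟩
      refine lt_of_le_of_lt ?_ hz
      have hh : 0 < z - s := sub_pos.2 hsz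
      have h1 := hA.norm_le_norm_sub_smul (hm _ hτ) hh
      have h2 : ‖W (T - s) - (z - s) • W' (T - s)‖ ≤ ‖W (T - z)‖ +
          (z - s) * ‖slope (fun z => W (T - z)) s z + W' (T - s)‖ := by
        have e : W (T - s) - (z - s) • W' (T - s) = W (T - z) -
            (z - s) • (slope (fun z => W (T - z)) s z + W' (T - s)) := by
          rw [smul_add, sub_smul_slope]
          simp only [vsub_eq_sub]
          abel
        rw [e]
        refine (norm_sub_le _ _).trans ?_
        rw [norm_smul, Real.norm_of_nonneg hh.le]
      rw [slope_def_field, div_le_iff₀ hh]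
      linarith)
    (right_mem_Icc.2 hT)
  simpa [h0] using key

theorem continuousOn_integral_of_continuousOn_Ici {u : ℝ → X} (hu : ContinuousOn u (Ici 0)) :
    ContinuousOn (fun t => ∫ s in (0 : ℝ)..t, u s) (Ici 0) := by
  intro t ht
  have hI : ContinuousOn (fun t => ∫ s in (0 : ℝ)..t, u s) (Icc 0 (t + 1)) := by
    have := intervalIntegral.continuousOn_primitive_interval (a := 0) (b := t + 1) (f := u)
      (μ := volume) (by
        rw [uIcc_of_le (by linarith [mem_Ici.1 ht])]
        exact (hu.mono Icc_subset_Ici_self).integrableOn_Icc)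
    rwa [uIcc_of_le (by linarith [mem_Ici.1 ht])] at this
  refine (hI t ⟨ht, by linarith⟩).mono_of_mem_nhdsWithin ?_
  rw [← Ici_inter_Iic]
  exact inter_mem self_mem_nhdsWithin (mem_nhdsWithin_of_mem_nhds (Iic_mem_nhds (by linarith)))

theorem IsIntegratedSemigroupOf.continuousOn {S : ℝ → X →L[𝕜] X}
    (hS : IsIntegratedSemigroupOf A S) : ContinuousOn S (Ici 0) := by
  refine (LipschitzOnWith.of_dist_le_mul (K := 1) fun t ht s hs => ?_).continuousOn
  simpa [dist_eq_norm] using hS.lipschitz s t hs ht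

theorem IsIntegratedSemigroupOf.norm_le {S : ℝ → X →L[𝕜] X}
    (hS : IsIntegratedSemigroupOf A S) {t : ℝ} (ht : 0 ≤ t) : ‖S t‖ ≤ t := by
  simpa [hS.zero, abs_of_nonneg ht] using hS.lipschitz 0 t le_rfl ht

variable [CompleteSpace X]

theorem hasDerivAt_integral_of_continuousOn_Ici {u : ℝ → X} (hu : ContinuousOn u (Ici 0)) {t : ℝ}
    (ht : 0 < t) : HasDerivAt (fun t => ∫ s in (0 : ℝ)..t, u s) (u t) t :=
  intervalIntegral.integral_hasDerivAt_right
    ((hu.mono (by rw [uIcc_of_le ht.le]; exact Icc_subset_Ici_self)).intervalIntegrable)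
    ((hu.mono Ioi_subset_Ici_self).stronglyMeasurableAtFilter isOpen_Ioi t ht)
    (hu.continuousAt (Ici_mem_nhds ht))

/-- In the difference of two solutions the terms `t • x` cancel, so its integral `W` is a
differentiable solution of `W' ∈ A W` starting at 0. It vanishes, and so does its derivative `v -
u`. -/
theorem Dissipative.eqOn_of_isMildSolution (hA : Dissipative A) {x : X} {u v : ℝ → X}
    (hu : IsMildSolution A x u) (hv : IsMildSolution A x v) : EqOn v u (Ici 0) := by
  have hc : ContinuousOn (fun t => v t - u t) (Ici 0) := hv.continuousOn.sub hu.continuousOn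
  have hW : ∀ t, 0 ≤ t → ∫ s in (0 : ℝ)..t, (v s - u s) = 0 := fun t ht =>
    hA.eq_zero_of_hasDerivAt (W := fun t => ∫ s in (0 : ℝ)..t, (v s - u s)) (by simp)
      (continuousOn_integral_of_continuousOn_Ici hc)
      (fun t ht => hasDerivAt_integral_of_continuousOn_Ici hc ht)
      (fun t ht => by
        have hi : ∀ {w : ℝ → X}, ContinuousOn w (Ici 0) → IntervalIntegrable w volume 0 t :=
          fun hw => (hw.mono (by
            rw [uIcc_of_le ht.le]; exact Icc_subset_Ici_self)).intervalIntegrable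
        convert A.sub_mem (hv.mem t ht.le) (hu.mem t ht.le) using 1
        rw [Prod.mk_sub_mk, Prod.mk.injEq]
        exact ⟨intervalIntegral.integral_sub (hi hv.continuousOn) (hi hu.continuousOn), by abel⟩)
      ht
  intro t ht
  rcases (mem_Ici.1 ht).eq_or_lt with rfl | ht0
  · rw [hu.initial, hv.initial]
  · have h1 := hasDerivAt_integral_of_continuousOn_Ici hc ht0
    have h2 : (fun t => ∫ s in (0 : ℝ)..t, (v s - u s)) =ᶠ[𝓝 t] fun _ => 0 := by
      filter_upwards [Ioi_mem_nhds ht0] with s hs using hW s (le_of_lt hs)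
    exact sub_eq_zero.1 (h1.unique ((hasDerivAt_const t (0 : X)).congr_of_eventuallyEq h2))

theorem IsIntegratedSemigroupOf.eqOn {S S' : ℝ → X →L[𝕜] X} (hS : IsIntegratedSemigroupOf A S)
    (hS' : IsIntegratedSemigroupOf A S') : EqOn S' S (Ici 0) := by
  have hb : ∀ {S : ℝ → X →L[𝕜] X}, IsIntegratedSemigroupOf A S →
      ∀ t, 0 ≤ t → ‖S t‖ ≤ 1 * (1 + t ^ 2) := fun hS t ht => by
    nlinarith [hS.norm_le ht, sq_nonneg (t - 1)]
  have h := eq_zero_of_laplace_eq_zero (f := fun t => S' t - S t) (C := 2)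
    (hS'.continuousOn.sub hS.continuousOn)
    (fun t ht => (norm_sub_le _ _).trans (by linarith [hb hS t ht, hb hS' t ht]))
    (fun l hl => by
      have e := (hS'.resolvent l hl).unique (hS.resolvent l hl)
      simp_rw [smul_sub]
      rw [integral_sub (integrableOn_exp_neg_smul hl hS'.continuousOn (hb hS'))
        (integrableOn_exp_neg_smul hl hS.continuousOn (hb hS))]
      exact sub_eq_zero.2 (smul_right_injective _ hl.ne' e))
  intro t ht
  rcases (mem_Ici.1 ht).eq_or_lt with rfl | ht0
  · rw [hS.zero, hS'.zero]
  · exact sub_eq_zero.1 (h ht0)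

theorem MDissipative.exists_isIntegratedSemigroupOf (hA : MDissipative A) :
    ∃ S : ℝ → X →L[𝕜] X, IsIntegratedSemigroupOf A S ∧
      ∀ x : X, IsMildSolution A x (fun t => S t x) := by
  choose! R hR hRn using fun l : ℝ => hA.exists_isResolventAt (l := l)
  let _ : Algebra ℝ (X →L[𝕜] X) :=
    Algebra.ofModule (fun r f g => smul_mul_assoc r f g) (fun r f g => mul_smul_comm r f g)
  let _ : NormedAlgebra ℝ (X →L[𝕜] X) := { norm_smul_le := norm_smul_le }
  have hRc : IsContractionResolvent R := by
    refine ⟨fun l m hl hm => ?_, fun l hl => ?_⟩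
    · ext x
      have h1 := (isResolventAt_iff.1 (hR m hm) (R m x) x).2 rfl
      -- `R m x` also solves the equation at `l`, with right-hand side `x + (l - m) R m x`; this is
      -- the resolvent identity.
      have h2 := (isResolventAt_iff.1 (hR l hl) (R m x) (x + ((l - m : ℝ) : 𝕜) • R m x)).1 (by
        convert h1 using 2
        push_cast
        module)
      rw [map_add, map_smul, ofReal_smul] at h2
      change R l x - R m x = (m - l) • R l (R m x)
      nth_rewrite 1 [h2]
      module
    · refine ContinuousLinearMap.opNorm_le_bound _ zero_le_one fun y => ?_
      change ‖l • R l y‖ ≤ 1 * ‖y‖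
      rw [norm_smul, Real.norm_of_nonneg hl.le, one_mul]
      exact hRn l hl y
  obtain ⟨S, S0, SL, SR, SW⟩ :=
    hRc.exists_integratedSemigroup_of_normedRing ContinuousLinearMap.norm_id_le
  have hS : IsIntegratedSemigroupOf A S :=
    ⟨S0, SL, fun l hl => by
      have := hR l hl
      rw [← SR l hl] at this
      exact this⟩
  refine ⟨S, hS, fun x => ⟨hS.continuousOn.clm_apply continuousOn_const, by simp [S0],
    fun t ht => ?_⟩⟩
  have hI : ∫ s in (0 : ℝ)..t, S s x = (∫ s in (0 : ℝ)..t, S s) x :=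
    (ContinuousLinearMap.intervalIntegral_apply
      ((hS.continuousOn.mono (by
        rw [uIcc_of_le ht]; exact Icc_subset_Ici_self)).intervalIntegrable) x).symm
  -- Read through the resolvent at 1, this identity says exactly that `(∫ S s x, S t x - t x)` lies
  -- in `A`.
  have hx : (∫ s in (0 : ℝ)..t, S s) x = R 1 ((∫ s in (0 : ℝ)..t, S s) x - S t x + t • x) :=
    congrArg (fun f : X →L[𝕜] X => f x) (SW t ht)
  have := (isResolventAt_iff.1 (hR 1 one_pos) _ _).2 hx
  rw [hI]
  convert this using 2
  simp only [RCLike.ofReal_one, one_smul]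
  abel

/-- The Laplace transform of the pair `(∫ u, u - t x)` stays in the closed space `A`. Scaled by `l ^
2`, its first component is `q = l ∫ exp (-l t) u`, and `l ^ 2 ∫ t exp (-l t) = 1` gives the bound.
-/
theorem mem_of_laplace {x : X} (hA : IsClosed (A : Set (X × X))) {u : ℝ → X}
    (hu : IsMildSolution A x u) (hb : ∀ t, 0 ≤ t → ‖u t‖ ≤ t * ‖x‖) {l : ℝ} (hl : 0 < l) :
    ∃ q : X, (q, (l : 𝕜) • q - x) ∈ A ∧ l * ‖q‖ ≤ ‖x‖ := by
  have hub : ∀ t, 0 ≤ t → ‖u t‖ ≤ ‖x‖ * (1 + t ^ 2) := fun t ht =>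
    (hb t ht).trans (by nlinarith [norm_nonneg x, sq_nonneg (t - 1)])
  let U : ℝ → X := fun t => ∫ s in (0 : ℝ)..t, u s
  have hUc : ContinuousOn U (Ici 0) := continuousOn_integral_of_continuousOn_Ici hu.continuousOn
  have hUb : ∀ t, 0 ≤ t → ‖U t‖ ≤ ‖x‖ * (1 + t ^ 2) := fun t ht => by
    have := intervalIntegral.norm_integral_le_of_norm_le_const (a := 0) (b := t) (f := u)
      (C := t * ‖x‖) (fun s hs => by
        rw [uIoc_of_le ht] at hs
        exact (hb s hs.1.le).trans (by gcongr; exact hs.2))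
    rw [sub_zero, abs_of_nonneg ht] at this
    exact this.trans (by nlinarith [norm_nonneg x])
  have hvc : ContinuousOn (fun t => u t - t • x) (Ici 0) :=
    hu.continuousOn.sub (by fun_prop)
  have hvb : ∀ t, 0 ≤ t → ‖u t - t • x‖ ≤ (2 * ‖x‖) * (1 + t ^ 2) := fun t ht => by
    refine (norm_sub_le _ _).trans ?_
    rw [norm_smul, Real.norm_of_nonneg ht]
    nlinarith [hb t ht, norm_nonneg x, mul_nonneg (norm_nonneg x) (sq_nonneg (t - 1))]
  have hxb : ∀ t, 0 ≤ t → ‖t • x‖ ≤ ‖x‖ * (1 + t ^ 2) := fun t ht => by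
    rw [norm_smul, Real.norm_of_nonneg ht]
    nlinarith [norm_nonneg x, mul_nonneg (norm_nonneg x) (sq_nonneg (t - 1))]
  have iu := integrableOn_exp_neg_smul hl hu.continuousOn hub
  have iU := integrableOn_exp_neg_smul hl hUc hUb
  have iv := integrableOn_exp_neg_smul hl hvc hvb
  have ix := integrableOn_exp_neg_smul (f := fun t => t • x) hl (by fun_prop) hxb
  have h1 : (l • ∫ t in Ioi (0 : ℝ), Real.exp (-(l * t)) • U t) =
      ∫ t in Ioi (0 : ℝ), Real.exp (-(l * t)) • u t :=
    smul_integral_exp_neg_smul_eq hl (by simp [U]) hUc hu.continuousOn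
      (fun t ht => hasDerivAt_integral_of_continuousOn_Ici hu.continuousOn ht) hUb hub
  have h2 : ∫ t in Ioi (0 : ℝ), Real.exp (-(l * t)) • (u t - t • x) =
      (∫ t in Ioi (0 : ℝ), Real.exp (-(l * t)) • u t) - (l ^ 2)⁻¹ • x := by
    simp_rw [smul_sub]
    rw [integral_sub iu ix]
    simp_rw [smul_smul, mul_comm (Real.exp _)]
    rw [integral_smul_const, integral_mul_exp_neg_mul_Ioi_zero hl]
  have hmem : ∫ t in Ioi (0 : ℝ), Real.exp (-(l * t)) • (U t, u t - t • x) ∈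
      A.restrictScalars ℝ := by
    refine Submodule.integral_mem_of_isClosed _ hA (iU.prodMk iv) ?_
    filter_upwards [ae_restrict_mem measurableSet_Ioi] with t ht
    exact (A.restrictScalars ℝ).smul_mem _ (hu.mem t (le_of_lt ht))
  simp_rw [Prod.smul_mk] at hmem
  rw [integral_pair iU iv, h2, ← h1] at hmem
  set V := ∫ t in Ioi (0 : ℝ), Real.exp (-(l * t)) • U t
  refine ⟨(l ^ 2) • V, ?_, ?_⟩
  · have h3 := (A.restrictScalars ℝ).smul_mem (l ^ 2) hmem
    rw [Submodule.restrictScalars_mem] at h3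
    convert h3 using 1
    rw [Prod.smul_mk, Prod.mk.injEq, ofReal_smul, smul_sub, smul_smul (l ^ 2) (l ^ 2)⁻¹,
      mul_inv_cancel₀ (by positivity), one_smul]
    exact ⟨rfl, by rw [smul_comm]⟩
  · have h3 := norm_smul_integral_exp_neg_smul_le (C := ‖x‖) hl fun t ht => by
      rw [mul_comm]; exact hb t ht
    rw [← h1] at h3
    calc l * ‖l ^ 2 • V‖ = ‖l • (l • (l • V))‖ := by
          rw [← norm_smul_of_nonneg hl.le, smul_smul, smul_smul, smul_smul]; ring_nf
      _ ≤ ‖x‖ := h3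

/-- An eigenvector yields an explicit solution of exponential growth, used to rule out positive
eigenvalues. -/
theorem isMildSolution_exp_mul_sub_one_smul {l : ℝ} (hl : 0 < l) {y : X}
    (hy : (y, l • y) ∈ A) : IsMildSolution A (l • y) (fun t => (Real.exp (l * t) - 1) • y) := by
  refine ⟨by fun_prop, by simp, fun t _ => ?_⟩
  have hI : ∫ s in (0 : ℝ)..t, (Real.exp (l * s) - 1) • y =
      ((Real.exp (l * t) - 1) / l - t) • y := by
    rw [intervalIntegral.integral_smul_const, intervalIntegral.integral_sub
      ((by fun_prop : Continuous fun s => Real.exp (l * s)).intervalIntegrable _ _)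
      (continuous_const.intervalIntegrable _ _), intervalIntegral.integral_comp_mul_left _ hl.ne']
    simp [div_eq_inv_mul]
  rw [hI]
  have h := (A.restrictScalars ℝ).smul_mem ((Real.exp (l * t) - 1) / l - t) hy
  rw [Submodule.restrictScalars_mem] at h
  convert h using 1
  rw [Prod.smul_mk, Prod.mk.injEq]
  refine ⟨rfl, ?_⟩
  rw [smul_smul, smul_smul, ← sub_smul]
  congr 1
  field_simp

theorem mDissipative_of_forall_isMildSolution (hA : IsClosed (A : Set (X × X)))
    (h : ∀ x : X, ∃ u : ℝ → X, IsMildSolution A x u ∧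
      (∀ v : ℝ → X, IsMildSolution A x v → EqOn v u (Ici 0)) ∧
      ∀ s t : ℝ, 0 ≤ s → 0 ≤ t → ‖u t - u s‖ ≤ |t - s| * ‖x‖) : MDissipative A := by
  -- Uniqueness enters here: every mild solution, not just the given one, inherits the linear bound.
  have hb : ∀ x : X, ∀ v : ℝ → X, IsMildSolution A x v → ∀ t, 0 ≤ t → ‖v t‖ ≤ t * ‖x‖ := by
    intro x v hv t ht
    obtain ⟨u, hu, huniq, hlip⟩ := h x
    have := hlip 0 t le_rfl ht
    rw [hu.initial, sub_zero, sub_zero, abs_of_nonneg ht] at this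
    rwa [huniq v hv ht]
  have hq : ∀ l : ℝ, 0 < l → ∀ x : X, ∃ q : X, (q, (l : 𝕜) • q - x) ∈ A ∧ l * ‖q‖ ≤ ‖x‖ := by
    intro l hl x
    obtain ⟨u, hu, -, -⟩ := h x
    exact mem_of_laplace hA hu (hb x u hu) hl
  have hinj : ∀ l : ℝ, 0 < l → ∀ y : X, (y, l • y) ∈ A → y = 0 := by
    intro l hl y hy
    by_contra hy0
    have hbd := fun t ht => hb _ _ (isMildSolution_exp_mul_sub_one_smul hl hy) t ht
    have hbd2 : ∀ t : ℝ, 0 ≤ t → Real.exp (l * t) - 1 ≤ l * t := fun t ht => by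
      have h1 := hbd t ht
      rw [norm_smul, norm_smul, Real.norm_of_nonneg hl.le, Real.norm_of_nonneg
        (sub_nonneg.2 (Real.one_le_exp (by positivity))), ← mul_assoc] at h1
      linarith [le_of_mul_le_mul_right h1 (norm_pos_iff.2 hy0)]
    -- At `t = 1 / l` the bound reads `e - 1 ≤ 1`, which is false.
    have h2 := hbd2 (1 / l) (by positivity)
    rw [mul_one_div_cancel hl.ne'] at h2
    linarith [Real.add_one_lt_exp one_ne_zero]
  refine ⟨fun x y hxy l hl => ?_, 1, one_pos, ran_shift_eq_top_iff.2 fun y => ?_⟩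
  -- Both `x` and `q` solve the resolvent equation with right-hand side `l x - y`. Injectivity
  -- identifies them, and the bound on `q` is the dissipativity estimate for `x`.
  · obtain ⟨q, hqA, hqn⟩ := hq l hl ((l : 𝕜) • x - y)
    have h0 : x - q = 0 := hinj l hl (x - q) (by
      convert A.sub_mem hxy hqA using 1
      rw [Prod.mk_sub_mk, Prod.mk.injEq, ← ofReal_smul (𝕜 := 𝕜)]
      exact ⟨rfl, by module⟩)
    rw [sub_eq_zero.1 h0, norm_smul, RCLike.norm_ofReal, abs_of_pos hl]
    rwa [sub_eq_zero.1 h0] at hqn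
  · obtain ⟨q, hqA, -⟩ := hq 1 one_pos y
    exact ⟨q, hqA⟩

end Evolution

end LinRel

theorem mainTheorem8 {𝕜 X : Type*} [RCLike 𝕜] [NormedAddCommGroup X] [NormedSpace 𝕜 X]
    [NormedSpace ℝ X] [IsScalarTower ℝ 𝕜 X] [CompleteSpace X]
    (A : Submodule 𝕜 (X × X)) (hA : IsClosed (A : Set (X × X))) :
    (LinRel.MDissipative A ↔
      ∀ x : X, ∃ u : ℝ → X, LinRel.IsMildSolution A x u ∧
        (∀ v : ℝ → X, LinRel.IsMildSolution A x v → Set.EqOn v u (Set.Ici 0)) ∧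
        ∀ s t : ℝ, 0 ≤ s → 0 ≤ t → ‖u t - u s‖ ≤ |t - s| * ‖x‖) ∧
    (LinRel.MDissipative A →
      ∃ S : ℝ → X →L[𝕜] X, LinRel.IsIntegratedSemigroupOf A S ∧
        (∀ S' : ℝ → X →L[𝕜] X, LinRel.IsIntegratedSemigroupOf A S' →
          Set.EqOn S' S (Set.Ici 0)) ∧
        ∀ x : X, LinRel.IsMildSolution A x (fun t => S t x) ∧
          ∀ u : ℝ → X, LinRel.IsMildSolution A x u → ∀ t : ℝ, 0 ≤ t → u t = S t x) := by
  refine ⟨⟨fun h x => ?_, LinRel.mDissipative_of_forall_isMildSolution hA⟩, fun h => ?_⟩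
  · obtain ⟨S, hS, hm⟩ := h.exists_isIntegratedSemigroupOf
    refine ⟨fun t => S t x, hm x, fun v hv => h.1.eqOn_of_isMildSolution (hm x) hv,
      fun s t hs ht => ?_⟩
    exact ((S t - S s).le_opNorm x).trans (by gcongr; exact hS.lipschitz s t hs ht)
  · obtain ⟨S, hS, hm⟩ := h.exists_isIntegratedSemigroupOf
    exact ⟨S, hS, fun S' hS' => hS.eqOn hS', fun x => ⟨hm x, fun u hu t ht =>
      h.1.eqOn_of_isMildSolution (hm x) hu ht⟩⟩
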